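/- Let $\mathcal H$ be a complex Hilbert space, $\mathcal{PS}$ the set of bounded positive semi-definite operators on $\mathcal H$, and $\mathcal P\subset\mathcal{PS}$ the set of invertible ones. An operator mean is a binary operation $\sigma:\mathcal{PS}^2\to\mathcal{PS}$ such that (i) $A\le C$ and $B\le D$ imply $\sigma(A,B)\le\sigma(C,D)$; (ii) $X^*\sigma(A,B)X\le\sigma(X^*AX,X^*BX)$ for every bounded operator $X$; (iii) $A_n\downarrow A$ and $B_n\downarrow B$ imply $\sigma(A_n,B_n)\downarrow\sigma(A,B)$ in the strong operator topology; (iv) $\sigma(I,I)=I$. It is $\lambda$-weighted if its representing function $f$ on $(0,\infty)$, given by $f(x)I=\sigma(I,xI)$, satisfies $f'(1)=\lambda$. **Theorem 5.1.** Let $\{\sigma_\lambda\}_{\lambda\in[0,1]}$ be a family such that each $\sigma_\lambda$ is a $\lambda$-weighted operator mean and $$\left[(1-\lambda)A^{-1}+\lambda B^{-1}\right]^{-1}\le\sigma_\lambda(A,B)\le(1-\lambda)A+\lambda B$$ for all $\lambda\in[0,1]$ and $A,B\in\mathcal P$. Then the following are equivalent. 1. There exists $t\in[-1,1]$ such that for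 all $\lambda\in[0,1]$ and all $A,B\in\mathcal P$ with $AB=BA$, $\sigma_\lambda(A,B)$ is the $\lambda$-weighted power mean with exponent $t$, that is, $$\sigma_\lambda(A,B)=A^{\frac12}\left[(1-\lambda)I+\lambda\left(A^{-\frac12}BA^{-\frac12}\right)^t\right]^{\frac1t}A^{\frac12},$$ where for $t=0$ the right-hand side means $A^{\frac12}\left(A^{-\frac12}BA^{-\frac12}\right)^{\lambda}A^{\frac12}$. 2. There exists an injective function $g:(0,\infty)\to\mathbb R$ such that for all $\lambda\in[0,1]$ and all $A,B\in\mathcal P$ with $AB=BA$, $$\sigma_\lambda(A,B)=g^{-1}\left((1-\lambda)g(A)+\lambda g(B)\right),$$ including that the right-hand side is defined by the continuous functional calculus: $g$ is continuous on the spectra of $A$ and $B$, the spectrum of $(1-\lambda)g(A)+\lambda g(B)$ is contained in $g((0,\infty))$, and $g^{-1}$ is continuous on that spectrum. -/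

import Mathlib

open Filter Topology Set

noncomputable section

namespace OpMean

variable {H : Type*} [NormedAddCommGroup H] [InnerProductSpace ℂ H] [CompleteSpace H]

/-- `A n ↓ L`: the sequence is decreasing for the Loewner order and converges to `L` in the strong
operator topology. -/
def DecreasesTo (A : ℕ → H →L[ℂ] H) (L : H →L[ℂ] H) : Prop :=
  Antitone A ∧ ∀ x : H, Tendsto (fun n => A n x) atTop (𝓝 (L x))

/-- Operator means in the sense of Kubo and Ando: binary operations on the positive semi-definite
operators on `H`.  Only the values of `σ` on pairs of positive semi-definite operators matter. -/
structure IsOperatorMean (σ : (H →L[ℂ] H) → (H →L[ℂ] H) → (H →L[ℂ] H)) : Prop where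
  nonneg : ∀ A B : H →L[ℂ] H, 0 ≤ A → 0 ≤ B → 0 ≤ σ A B
  mono : ∀ A B C D : H →L[ℂ] H, 0 ≤ A → 0 ≤ B → A ≤ C → B ≤ D → σ A B ≤ σ C D
  transformer : ∀ A B X : H →L[ℂ] H, 0 ≤ A → 0 ≤ B →
    star X * σ A B * X ≤ σ (star X * A * X) (star X * B * X)
  continuous_below : ∀ (A B : ℕ → H →L[ℂ] H) (A' B' : H →L[ℂ] H),
    (∀ n, 0 ≤ A n) → (∀ n, 0 ≤ B n) → DecreasesTo A A' → DecreasesTo B B' →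
      DecreasesTo (fun n => σ (A n) (B n)) (σ A' B')
  one_one : σ 1 1 = 1

/-- `f` is the representing function of `σ` on `(0, ∞)`: `σ(I, xI) = f(x) I`. -/
def IsRepresentingFunction (σ : (H →L[ℂ] H) → (H →L[ℂ] H) → (H →L[ℂ] H)) (f : ℝ → ℝ) : Prop :=
  ∀ x : ℝ, 0 < x → σ 1 (x • (1 : H →L[ℂ] H)) = f x • (1 : H →L[ℂ] H)

/-- A `lam`-weighted operator mean: an operator mean whose representing function `f`
satisfies `f'(1) = lam`. -/
def IsWeightedOperatorMean (lam : ℝ) (σ : (H →L[ℂ] H) → (H →L[ℂ] H) → (H →L[ℂ] H)) : Prop :=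
  IsOperatorMean σ ∧ ∃ f : ℝ → ℝ, IsRepresentingFunction σ f ∧ HasDerivAt f lam 1

/-- The weighted arithmetic mean `(1 - lam) A + lam B`. -/
def arithMean (lam : ℝ) (A B : H →L[ℂ] H) : H →L[ℂ] H :=
  (1 - lam) • A + lam • B

/-- The weighted harmonic mean `[(1 - lam) A⁻¹ + lam B⁻¹]⁻¹` (of invertible positive operators). -/
def harmMean (lam : ℝ) (A B : H →L[ℂ] H) : H →L[ℂ] H :=
  Ring.inverse ((1 - lam) • Ring.inverse A + lam • Ring.inverse B)

/-- The weighted power mean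
`A^(1/2) [(1 - lam) I + lam (A^(-1/2) B A^(-1/2))^t]^(1/t) A^(1/2)` of invertible positive
operators; for `t = 0` it is the limit as `t → 0`, the weighted geometric mean
`A^(1/2) (A^(-1/2) B A^(-1/2))^lam A^(1/2)`. -/
def powerMean (t lam : ℝ) (A B : H →L[ℂ] H) : H →L[ℂ] H :=
  if t = 0 then
    A ^ (1 / 2 : ℝ) * (A ^ (-1 / 2 : ℝ) * B * A ^ (-1 / 2 : ℝ)) ^ lam * A ^ (1 / 2 : ℝ)
  else
    A ^ (1 / 2 : ℝ) *
      ((1 - lam) • (1 : H →L[ℂ] H)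
        + lam • (A ^ (-1 / 2 : ℝ) * B * A ^ (-1 / 2 : ℝ)) ^ t) ^ (1 / t) *
      A ^ (1 / 2 : ℝ)

/-- The inverse function `g⁻¹ : g((0, ∞)) → (0, ∞)` of a function `g` that is injective on
`(0, ∞)`. -/
def inverseFn (g : ℝ → ℝ) : ℝ → ℝ :=
  Function.invFunOn g (Ioi 0)

/-- The equation `S = g⁻¹((1 - lam) g(A) + lam g(B))` in the sense of the continuous functional
calculus, including that its right-hand side makes sense: `g` is continuous on the spectra
of `A` and of `B`, the spectrum of `(1 - lam) g(A) + lam g(B)` lies in the domain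
`g((0, ∞))` of `g⁻¹`, and `g⁻¹` is continuous on that spectrum. -/
structure EqQuasiArithmetic (g : ℝ → ℝ) (lam : ℝ) (A B S : H →L[ℂ] H) : Prop where
  continuousOn_left : ContinuousOn g (spectrum ℝ A)
  continuousOn_right : ContinuousOn g (spectrum ℝ B)
  spectrum_subset : spectrum ℝ ((1 - lam) • cfc g A + lam • cfc g B) ⊆ g '' Ioi 0
  continuousOn_inverse :
    ContinuousOn (inverseFn g) (spectrum ℝ ((1 - lam) • cfc g A + lam • cfc g B))
  eq : S = cfc (inverseFn g) ((1 - lam) • cfc g A + lam • cfc g B)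

end OpMean

end

/-! From exponent to generator: commuting positive operators have commuting logarithms, so the
factors `A ^ (±1/2)` cancel and the power mean becomes the quasi-arithmetic mean of `x ^ t`, or of
`log` when `t = 0` (`eqQuasiArithmetic_powerMean`).

Conversely, scalar operators already determine `g`. There `σ` becomes a numerical mean `m` with `g
(m l a b) = (1 - l) * g a + l * g b`. The transformer inequality makes `m` homogeneous, and the
harmonic and arithmetic bounds place it between its arguments. Since all weights occur and `g` is
injective, betweenness forces `g` to be monotone, and homogeneity makes `g (c * x)` an affine
function of `g x`. This reduces to Cauchy's equation, where monotonicity supplies the regularity, so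
`g` is affine in `x ^ t` or `log x` (`exists_powerGenerator_of_homogeneous`). The bounds at `1`, `2`
with weight `1/2` confine `t` to `[-1, 1]`. Affinely equivalent generators give the same mean, which
carries the conclusion back to operators. -/

/-! ### Functional equations on the half-line. -/

section PowerFunction

/-- The generator of the power mean with exponent `t`: `x ^ t`, and `log x` for `t = 0`. -/
noncomputable def powerGenerator (t x : ℝ) : ℝ :=
  if t = 0 then Real.log x else x ^ t

/-- Failure of both monotonicities is always witnessed by three points whose middle value is a
strict extremum, so no continuity is needed. -/
lemma monotone_or_antitone_of_between {g : ℝ → ℝ}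
    (hbetween : ∀ ⦃a b c⦄, 0 < a → a < b → b < c → ¬ (g a < g b ∧ g c < g b) ∧
      ¬ (g b < g a ∧ g b < g c)) :
    MonotoneOn g (Ioi 0) ∨ AntitoneOn g (Ioi 0) := by
  by_contra! h
  obtain ⟨a, ha, b, hb, c, hc, hab, hbc, h⟩ :=
    not_monotoneOn_not_antitoneOn_iff_exists_lt_lt.1 h
  have := hbetween ha hab hbc
  tauto

/-- Monotone solutions of Cauchy's equation `f (x y) = f x + f y` on `(0, ∞)` are multiples of the
logarithm. -/
lemma exists_eq_mul_log {f : ℝ → ℝ} (hf : MonotoneOn f (Ioi 0) ∨ AntitoneOn f (Ioi 0))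
    (hmul : ∀ x y, 0 < x → 0 < y → f (x * y) = f x + f y) :
    ∃ k : ℝ, ∀ x, 0 < x → f x = k * Real.log x := by
  -- In exponential coordinates `f` is additive; monotone implies measurable, and a measurable
  -- additive map is continuous, hence linear.
  let L : ℝ →+ ℝ := AddMonoidHom.mk' (fun s => f (Real.exp s)) fun s u => by
    rw [Real.exp_add, hmul _ _ (Real.exp_pos s) (Real.exp_pos u)]
  have hmeas : Measurable L := by
    rcases hf with hf | hf
    · exact Monotone.measurable fun s u h =>
        hf (Real.exp_pos s) (Real.exp_pos u) (Real.exp_le_exp.2 h)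
    · exact Antitone.measurable fun s u h =>
        hf (Real.exp_pos s) (Real.exp_pos u) (Real.exp_le_exp.2 h)
  have hcont : Continuous L := MeasureTheory.Measure.AddMonoidHom.continuous_of_measurable L hmeas
  refine ⟨L 1, fun x hx => ?_⟩
  have h := (L.toRealLinearMap hcont).map_smul (Real.log x) 1
  simpa [L, Real.exp_log hx, mul_comm] using h

/-- If dilations act on `g` by affine maps, then `g` is affinely equivalent to a power function or
to the logarithm. -/
lemma exists_eq_powerGenerator {g α : ℝ → ℝ} (hinj : InjOn g (Ioi 0))
    (hmono : MonotoneOn g (Ioi 0) ∨ AntitoneOn g (Ioi 0)) (hone : g 1 = 0)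
    (hg : ∀ c x, 0 < c → 0 < x → g (c * x) = α c * g x + g c) :
    ∃ t k β : ℝ, k ≠ 0 ∧ ∀ x, 0 < x → g x = k * powerGenerator t x + β := by
  have hne : ∀ x, 0 < x → x ≠ 1 → g x ≠ 0 := fun x hx h1 h0 =>
    h1 (hinj hx (mem_Ioi.2 one_pos) (h0.trans hone.symm))
  have h2 := hne 2 two_pos (by norm_num)
  -- Expand `g (2 * x)` with either factor as the dilation and compare.
  have hα : ∀ x, 0 < x → α x = 1 + (α 2 - 1) / g 2 * g x := fun x hx => by
    have h₁ := hg x 2 hx two_pos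
    have h₂ := hg 2 x two_pos hx
    rw [mul_comm] at h₂
    field_simp
    linarith
  set κ := (α 2 - 1) / g 2 with hκ
  -- If `κ = 0` then `α = 1` and `g` is logarithmic; otherwise `α = 1 + κ * g` is multiplicative,
  -- hence a power.
  by_cases hk : κ = 0
  · obtain ⟨k, hk⟩ := exists_eq_mul_log hmono fun x y hx hy => by
      rw [hg x y hx hy, hα x hx, hk]; ring
    refine ⟨0, k, 0, ?_, fun x hx => by simp [powerGenerator, hk x hx]⟩
    rintro rfl
    exact h2 (by simp [hk 2 two_pos])
  · have hαmul : ∀ x y, 0 < x → 0 < y → α (x * y) = α x * α y := fun x y hx hy => by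
      rw [hα _ (mul_pos hx hy), hg x y hx hy, hα y hy]
      linear_combination -hα x hx
    have hαpos : ∀ x, 0 < x → 0 < α x := fun x hx => by
      have hs : 0 < √x := Real.sqrt_pos.2 hx
      have h1 : α 1 = 1 := by rw [hα 1 one_pos, hone]; ring
      have hne0 : α (√x) ≠ 0 := fun h0 => by
        have := hαmul (√x) (√x)⁻¹ hs (inv_pos.2 hs)
        rw [mul_inv_cancel₀ hs.ne', h1, h0] at this
        simp at this
      rw [← Real.mul_self_sqrt hx.le, hαmul _ _ hs hs]
      exact mul_self_pos.2 hne0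
    have hαmono : MonotoneOn (fun x => Real.log (α x)) (Ioi 0) ∨
        AntitoneOn (fun x => Real.log (α x)) (Ioi 0) := by
      have key : ∀ x y, 0 < x → 0 < y → κ * g x ≤ κ * g y →
          Real.log (α x) ≤ Real.log (α y) := fun x y hx hy h =>
        Real.log_le_log (hαpos x hx) (by rw [hα x hx, hα y hy]; linarith)
      rcases hmono with hm | hm <;> rcases le_total 0 κ with h0 | h0
      · exact .inl fun x hx y hy h => key x y hx hy (mul_le_mul_of_nonneg_left (hm hx hy h) h0)
      · exact .inr fun x hx y hy h => key y x hy hx (mul_le_mul_of_nonpos_left (hm hx hy h) h0)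
      · exact .inr fun x hx y hy h => key y x hy hx (mul_le_mul_of_nonneg_left (hm hx hy h) h0)
      · exact .inl fun x hx y hy h => key x y hx hy (mul_le_mul_of_nonpos_left (hm hx hy h) h0)
    obtain ⟨t, ht⟩ := exists_eq_mul_log hαmono fun x y hx hy => by
      rw [hαmul x y hx hy, Real.log_mul (hαpos x hx).ne' (hαpos y hy).ne']
    have hpow : ∀ x, 0 < x → α x = x ^ t := fun x hx => by
      rw [Real.rpow_def_of_pos hx, mul_comm, ← ht x hx, Real.exp_log (hαpos x hx)]
    have hgx : ∀ x, 0 < x → g x = κ⁻¹ * x ^ t + -κ⁻¹ := fun x hx => by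
      have := hα x hx
      rw [hpow x hx] at this
      rw [this]
      field_simp
      ring
    have ht0 : t ≠ 0 := by
      rintro rfl
      exact h2 (by simp [hgx 2 two_pos])
    exact ⟨t, κ⁻¹, -κ⁻¹, inv_ne_zero hk, fun x hx => by simp [powerGenerator, ht0, hgx x hx]⟩

/-- A homogeneous weighted quasi-arithmetic mean which lies between the minimum and the maximum is
generated by a power function or by the logarithm. -/
lemma exists_powerGenerator_of_homogeneous {g : ℝ → ℝ} (hinj : InjOn g (Ioi 0))
    {m : ℝ → ℝ → ℝ → ℝ}
    (hpos : ∀ l ∈ Icc (0 : ℝ) 1, ∀ a b, 0 < a → 0 < b → 0 < m l a b)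
    (hm : ∀ l ∈ Icc (0 : ℝ) 1, ∀ a b, 0 < a → 0 < b → g (m l a b) = (1 - l) * g a + l * g b)
    (hhom : ∀ l ∈ Icc (0 : ℝ) 1, ∀ c a b, 0 < c → 0 < a → 0 < b →
      m l (c * a) (c * b) = c * m l a b)
    (hbd : ∀ l ∈ Icc (0 : ℝ) 1, ∀ a b, 0 < a → a ≤ b → a ≤ m l a b ∧ m l a b ≤ b) :
    ∃ t k β : ℝ, k ≠ 0 ∧ ∀ x, 0 < x → g x = k * powerGenerator t x + β := by
  have hseg : ∀ v a b, v ∈ segment ℝ (g a) (g b) →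
      ∃ l ∈ Icc (0 : ℝ) 1, v = (1 - l) * g a + l * g b := by
    rintro v a b ⟨p, q, hp, hq, hpq, rfl⟩
    exact ⟨q, ⟨hq, by linarith⟩, by rw [← hpq]; simp⟩
  -- By injectivity, any point whose `g`-value lies between those of `a` and `b` is itself a mean of
  -- `a` and `b`.
  have hmem : ∀ x a b, 0 < x → 0 < a → 0 < b → g x ∈ segment ℝ (g a) (g b) →
      ∃ l ∈ Icc (0 : ℝ) 1, g x = (1 - l) * g a + l * g b ∧ x = m l a b := by
    intro x a b hx ha hb h
    obtain ⟨l, hl, hv⟩ := hseg _ a b h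
    exact ⟨l, hl, hv, hinj hx (hpos l hl a b ha hb) (hv.trans (hm l hl a b ha hb).symm)⟩
  have hloc : ∀ x a b, 0 < x → 0 < a → a ≤ b → g x ∈ segment ℝ (g a) (g b) →
      a ≤ x ∧ x ≤ b := by
    intro x a b hx ha hab h
    obtain ⟨l, hl, -, rfl⟩ := hmem x a b hx ha (ha.trans_le hab) h
    exact hbd l hl a b ha hab
  have hmono : MonotoneOn g (Ioi 0) ∨ AntitoneOn g (Ioi 0) := by
    refine monotone_or_antitone_of_between fun a b c ha hab hbc => ?_
    have hb := ha.trans hab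
    have h₁ : g a ∉ segment ℝ (g b) (g c) := fun h =>
      hab.not_ge (hloc a b c ha hb hbc.le h).1
    have h₂ : g c ∉ segment ℝ (g a) (g b) := fun h =>
      hbc.not_ge (hloc c a b (hb.trans hbc) ha hab.le h).2
    rw [segment_eq_uIcc, mem_uIcc] at h₁ h₂
    constructor <;> rintro ⟨h₃, h₄⟩ <;> rcases le_total (g a) (g c) with h | h <;>
      first
      | exact h₁ (.inl ⟨by linarith, by linarith⟩)
      | exact h₁ (.inr ⟨by linarith, by linarith⟩)
      | exact h₂ (.inl ⟨by linarith, by linarith⟩)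
      | exact h₂ (.inr ⟨by linarith, by linarith⟩)
  -- If `q` is the mean of `p` and `r` with weight `l`, then `c * q` is the mean of `c * p` and `c *
  -- r` with the same weight; eliminating `l` gives collinearity of the points `(g x, g (c * x))`.
  have hcol : ∀ c p q r, 0 < c → 0 < p → p ≤ q → q ≤ r →
      (g q - g p) * (g (c * r) - g (c * p)) = (g r - g p) * (g (c * q) - g (c * p)) := by
    intro c p q r hc hp hpq hqr
    have hq := hp.trans_le hpq
    have hr := hq.trans_le hqr
    have hs : g q ∈ segment ℝ (g p) (g r) := by
      rw [segment_eq_uIcc, mem_uIcc]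
      rcases hmono with h | h
      · exact .inl ⟨h hp hq hpq, h hq hr hqr⟩
      · exact .inr ⟨h hq hr hqr, h hp hq hpq⟩
    obtain ⟨l, hl, h₁, h₂⟩ := hmem q p r hq hp hr hs
    have h₃ := hm l hl (c * p) (c * r) (mul_pos hc hp) (mul_pos hc hr)
    rw [hhom l hl c p r hc hp hr, ← h₂] at h₃
    rw [h₁, h₃]
    ring
  have hcol' : ∀ c x, 0 < c → 0 < x →
      (g x - g 1) * (g (c * 2) - g c) = (g 2 - g 1) * (g (c * x) - g c) := by
    intro c x hc hx
    rcases le_total x 1 with h | h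
    · have := hcol c x 1 2 hc hx h one_le_two
      rw [mul_one] at this
      linarith
    · rcases le_total x 2 with h' | h'
      · have := hcol c 1 x 2 hc one_pos h h'
        rw [mul_one] at this
        linarith
      · have := hcol c 1 2 x hc one_pos one_le_two h'
        rw [mul_one] at this
        linarith
  have h21 : g 2 - g 1 ≠ 0 := sub_ne_zero.2 fun h =>
    absurd (hinj (mem_Ioi.2 two_pos) (mem_Ioi.2 one_pos) h) (by norm_num)
  obtain ⟨t, k, β, hk, h⟩ := exists_eq_powerGenerator (g := fun x => g x - g 1)
    (α := fun c => (g (c * 2) - g c) / (g 2 - g 1))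
    (fun x hx y hy h => hinj hx hy (by simpa using h))
    (hmono.imp (fun h x hx y hy hxy => sub_le_sub_right (h hx hy hxy) _)
      (fun h x hx y hy hxy => sub_le_sub_right (h hx hy hxy) _)) (sub_self _)
    fun c x hc hx => by
      have := hcol' c x hc hx
      field_simp
      linarith
  exact ⟨t, k, β + g 1, hk, fun x hx => by linarith [h x hx]⟩

/-- The power mean of `1` and `2` with equal weights bounds its exponent. -/
lemma exponent_mem_Icc {t k β y z : ℝ} (hk : k ≠ 0) (hy : 0 < y)
    (hyle : y ≤ (1 + 2) / 2) (hzle : 4 / 3 ≤ z)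
    (hyeq : k * powerGenerator t y + β =
      (k * powerGenerator t 1 + β + (k * powerGenerator t 2 + β)) / 2)
    (hzeq : k * powerGenerator t z + β =
      (k * powerGenerator t 1 + β + (k * powerGenerator t 2 + β)) / 2) :
    t ∈ Icc (-1 : ℝ) 1 := by
  have hconv : ∀ s : ℝ, 1 < s → ∀ a b : ℝ, 0 < a → 0 < b → a ≠ b →
      ((a + b) / 2) ^ s < (a ^ s + b ^ s) / 2 := by
    intro s hs a b ha hb hab
    have := (strictConvexOn_rpow hs).2 (mem_Ici.2 ha.le) (mem_Ici.2 hb.le) hab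
      (show (0 : ℝ) < 1 / 2 by norm_num) (show (0 : ℝ) < 1 / 2 by norm_num) (by norm_num)
    simp only [smul_eq_mul] at this
    calc ((a + b) / 2) ^ s = (1 / 2 * a + 1 / 2 * b) ^ s := by ring_nf
      _ < _ := this
      _ = _ := by ring
  have red : ∀ w, t ≠ 0 → k * powerGenerator t w + β =
      (k * powerGenerator t 1 + β + (k * powerGenerator t 2 + β)) / 2 →
      w ^ t = (1 ^ t + 2 ^ t) / 2 := fun w ht h => by
    simp only [powerGenerator, ht, if_false] at h
    exact mul_left_cancel₀ hk (by linarith)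
  -- For `t < -1`, strict convexity of `x ^ (-t)` at `1` and `1/2` contradicts the harmonic bound
  -- `4/3`; for `t > 1`, that of `x ^ t` at `1` and `2` contradicts the arithmetic bound `3/2`.
  constructor <;> by_contra! ht
  · have h := red z (by linarith) hzeq
    have h₁ := hconv (-t) (by linarith) 1 (1 / 2) (by norm_num) (by norm_num) (by norm_num)
    have h₂ : z ^ t ≤ (4 / 3 : ℝ) ^ t :=
      Real.rpow_le_rpow_of_nonpos (by norm_num) hzle (by linarith)
    have h₃ : ((1 + 1 / 2) / 2 : ℝ) ^ (-t) = (4 / 3 : ℝ) ^ t := by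
      rw [Real.rpow_neg (by norm_num), ← Real.inv_rpow (by norm_num)]; norm_num
    have h₄ : (1 / 2 : ℝ) ^ (-t) = 2 ^ t := by
      rw [Real.rpow_neg (by norm_num), ← Real.inv_rpow (by norm_num)]; norm_num
    rw [h₃, h₄, Real.one_rpow] at h₁
    rw [Real.one_rpow] at h
    linarith
  · have h := red y (by linarith) hyeq
    have h₁ := hconv t ht 1 2 (by norm_num) (by norm_num) (by norm_num)
    have h₂ := Real.rpow_le_rpow hy.le hyle (by linarith : 0 ≤ t)
    linarith

end PowerFunction

namespace OpMean

variable {H : Type*} [NormedAddCommGroup H] [InnerProductSpace ℂ H] [CompleteSpace H]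

/-! ### Power means of commuting operators via exponentials and logarithms. -/

section FunctionalCalculus

open NormedSpace (exp)

lemma exp_add_of_commute {a b : H →L[ℂ] H} (h : Commute a b) :
    exp (a + b) = exp a * exp b :=
  letI : NormedAlgebra ℚ (H →L[ℂ] H) := NormedAlgebra.restrictScalars ℚ ℝ _
  NormedSpace.exp_add_of_commute h

lemma isStrictlyPositive_exp {a : H →L[ℂ] H} (ha : IsSelfAdjoint a) :
    IsStrictlyPositive (exp a) :=
  letI : NormedAlgebra ℚ (H →L[ℂ] H) := NormedAlgebra.restrictScalars ℚ ℝ _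
  (NormedSpace.isUnit_exp a).isStrictlyPositive ha.exp_nonneg

lemma exp_rpow {a : H →L[ℂ] H} (ha : IsSelfAdjoint a) (t : ℝ) : (exp a) ^ t = exp (t • a) := by
  rw [← CFC.real_exp_eq_normedSpace_exp ha, CFC.cfc_rpow (fun x _ => Real.exp_pos x),
    ← CFC.real_exp_eq_normedSpace_exp ((IsSelfAdjoint.all t).smul ha), ← cfc_comp_smul t Real.exp a]
  congr 1
  ext x
  rw [← Real.exp_mul, smul_eq_mul, mul_comm]

lemma rpow_eq_exp_smul_log {A : H →L[ℂ] H} (hA : IsStrictlyPositive A) (t : ℝ) :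
    A ^ t = exp (t • CFC.log A) := by
  conv_lhs => rw [← CFC.exp_log A hA]
  exact exp_rpow IsSelfAdjoint.log t

lemma isStrictlyPositive_convexComb {A B : H →L[ℂ] H} (hA : IsStrictlyPositive A)
    (hB : IsStrictlyPositive B) {l : ℝ} (hl : l ∈ Icc (0 : ℝ) 1) :
    IsStrictlyPositive ((1 - l) • A + l • B) := by
  rcases hl.1.eq_or_lt with rfl | h
  · simpa using hA
  · exact IsStrictlyPositive.nonneg_add (smul_nonneg (by linarith [hl.2]) hA.nonneg)
      (hB.smul h)

lemma exp_half_smul_mul_exp_mul {a c : H →L[ℂ] H} (h : Commute a c) :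
    exp ((1 / 2 : ℝ) • a) * exp c * exp ((1 / 2 : ℝ) • a) = exp (a + c) := by
  rw [← exp_add_of_commute (h.smul_left _),
    ← exp_add_of_commute
      ((((Commute.refl a).smul_left _).add_left h.symm).smul_right _)]
  congr 1
  module

lemma commute_log {A B : H →L[ℂ] H} (hAB : Commute A B) : Commute (CFC.log A) (CFC.log B) :=
  ((hAB.cfc_real Real.log).symm.cfc_real Real.log).symm

lemma rpow_neg_half_mul_mul {A B : H →L[ℂ] H} (hA : IsStrictlyPositive A)
    (hB : IsStrictlyPositive B) (hAB : Commute A B) :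
    A ^ (-1 / 2 : ℝ) * B * A ^ (-1 / 2 : ℝ) = exp (CFC.log B - CFC.log A) := by
  have h := exp_half_smul_mul_exp_mul (commute_log hAB).neg_left
  rw [rpow_eq_exp_smul_log hA]
  conv_lhs => rw [← CFC.exp_log B hB]
  rw [show (-1 / 2 : ℝ) • CFC.log A = (1 / 2 : ℝ) • -CFC.log A by module, h]
  congr 1
  abel

/-- The power mean of commuting operators, for exponents `t ≠ 0`. -/
lemma powerMean_of_commute {A B : H →L[ℂ] H} (hA : IsStrictlyPositive A)
    (hB : IsStrictlyPositive B) (hAB : Commute A B) {l : ℝ} (hl : l ∈ Icc (0 : ℝ) 1) {t : ℝ}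
    (ht : t ≠ 0) :
    powerMean t l A B = ((1 - l) • A ^ t + l • B ^ t) ^ (1 / t) := by
  have hab := commute_log hAB
  have hsa : IsSelfAdjoint (CFC.log A) := IsSelfAdjoint.log
  have hsba : IsSelfAdjoint (CFC.log B - CFC.log A) := IsSelfAdjoint.log.sub hsa
  rw [powerMean, if_neg ht, rpow_neg_half_mul_mul hA hB hAB, exp_rpow hsba,
    rpow_eq_exp_smul_log hA, rpow_eq_exp_smul_log hA, rpow_eq_exp_smul_log hB]
  set a := CFC.log A
  set b := CFC.log B
  set C := (1 - l) • (1 : H →L[ℂ] H) + l • exp (t • (b - a)) with hC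
  have hCpos : IsStrictlyPositive C :=
    isStrictlyPositive_convexComb isStrictlyPositive_one
      (isStrictlyPositive_exp ((IsSelfAdjoint.all t).smul hsba)) hl
  have haba : Commute a (t • (b - a)) := (hab.sub_right (Commute.refl a)).smul_right t
  have haC : Commute a C :=
    ((Commute.one_right a).smul_right _).add_right ((haba.exp_right).smul_right _)
  have hac : Commute a (CFC.log C) := (haC.symm.cfc_real Real.log).symm
  -- Factor `exp (t • a)`, that is `A ^ t`, out of the sum; taking the power `1 / t` then restores
  -- one full factor `A`.
  have hsum : (1 - l) • exp (t • a) + l • exp (t • b) = exp (t • a + CFC.log C) := by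
    rw [exp_add_of_commute (hac.smul_left t), CFC.exp_log C hCpos, hC, mul_add,
      mul_smul_comm, mul_smul_comm, mul_one, ← exp_add_of_commute (haba.smul_left t)]
    congr 4
    module
  rw [hsum, exp_rpow (((IsSelfAdjoint.all t).smul hsa).add IsSelfAdjoint.log),
    rpow_eq_exp_smul_log hCpos, exp_half_smul_mul_exp_mul (hac.smul_right _), smul_add, smul_smul,
    one_div_mul_cancel ht, one_smul]

lemma powerMean_zero_of_commute {A B : H →L[ℂ] H} (hA : IsStrictlyPositive A)
    (hB : IsStrictlyPositive B) (hAB : Commute A B) (l : ℝ) :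
    powerMean 0 l A B = exp ((1 - l) • CFC.log A + l • CFC.log B) := by
  have hab : Commute (CFC.log A) (l • (CFC.log B - CFC.log A)) :=
    ((commute_log hAB).sub_right (Commute.refl _)).smul_right l
  have hsa : IsSelfAdjoint (CFC.log A) := IsSelfAdjoint.log
  have hsb : IsSelfAdjoint (CFC.log B) := IsSelfAdjoint.log
  rw [powerMean, if_pos rfl, rpow_neg_half_mul_mul hA hB hAB, exp_rpow (hsb.sub hsa),
    rpow_eq_exp_smul_log hA, exp_half_smul_mul_exp_mul hab]
  congr 1
  module

end FunctionalCalculus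

/-! ### Quasi-arithmetic form of the power mean. -/

section QuasiArithmetic

/-- A left inverse of `powerGenerator t` on `(0, ∞)`. -/
noncomputable def powerGeneratorInv (t y : ℝ) : ℝ :=
  if t = 0 then Real.exp y else y ^ (1 / t)

lemma powerGeneratorInv_powerGenerator (t : ℝ) {x : ℝ} (hx : 0 < x) :
    powerGeneratorInv t (powerGenerator t x) = x := by
  by_cases ht : t = 0
  · simp [powerGenerator, powerGeneratorInv, ht, Real.exp_log hx]
  · simp [powerGenerator, powerGeneratorInv, ht, Real.rpow_rpow_inv hx.le]

lemma powerGenerator_zero : powerGenerator 0 = Real.log := by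
  ext; simp [powerGenerator]

lemma powerGenerator_of_ne_zero {t : ℝ} (ht : t ≠ 0) : powerGenerator t = fun x => x ^ t := by
  ext; simp [powerGenerator, ht]

lemma powerGeneratorInv_zero : powerGeneratorInv 0 = Real.exp := by
  ext; simp [powerGeneratorInv]

lemma powerGeneratorInv_of_ne_zero {t : ℝ} (ht : t ≠ 0) :
    powerGeneratorInv t = fun y => y ^ (1 / t) := by
  ext; simp [powerGeneratorInv, ht]

lemma continuousOn_powerGenerator (t : ℝ) : ContinuousOn (powerGenerator t) (Ioi 0) := by
  rcases eq_or_ne t 0 with rfl | ht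
  · rw [powerGenerator_zero]
    exact Real.continuousOn_log.mono fun x hx => (mem_Ioi.1 hx).ne'
  · rw [powerGenerator_of_ne_zero ht]
    exact continuousOn_id.rpow_const fun x hx => .inl (mem_Ioi.1 hx).ne'

lemma continuousOn_powerGeneratorInv (t : ℝ) :
    ContinuousOn (powerGeneratorInv t) (powerGenerator t '' Ioi 0) := by
  rcases eq_or_ne t 0 with rfl | ht
  · rw [powerGeneratorInv_zero]
    exact Real.continuous_exp.continuousOn
  · rw [powerGeneratorInv_of_ne_zero ht, powerGenerator_of_ne_zero ht]
    refine continuousOn_id.rpow_const ?_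
    rintro _ ⟨x, hx, rfl⟩
    exact .inl (Real.rpow_pos_of_pos hx t).ne'

lemma spectrum_powerGenerator_comb_subset {A B : H →L[ℂ] H} (hA : IsStrictlyPositive A)
    (hB : IsStrictlyPositive B) {l : ℝ} (hl : l ∈ Icc (0 : ℝ) 1) (t : ℝ) :
    spectrum ℝ ((1 - l) • cfc (powerGenerator t) A + l • cfc (powerGenerator t) B) ⊆
      powerGenerator t '' Ioi 0 := by
  intro y hy
  by_cases ht : t = 0
  · exact ⟨Real.exp y, Real.exp_pos y, by simp [powerGenerator, ht]⟩
  · rw [powerGenerator_of_ne_zero ht, ← CFC.rpow_eq_cfc_real hA.nonneg,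
      ← CFC.rpow_eq_cfc_real hB.nonneg] at hy
    have hy0 := (isStrictlyPositive_convexComb (hA.rpow _ t) (hB.rpow _ t) hl).spectrum_pos hy
    exact ⟨y ^ t⁻¹, Real.rpow_pos_of_pos hy0 _, by
      simp [powerGenerator, ht, Real.rpow_inv_rpow hy0.le]⟩

lemma cfc_powerGeneratorInv_comb {A B : H →L[ℂ] H} (hA : IsStrictlyPositive A)
    (hB : IsStrictlyPositive B) (hAB : Commute A B) {l : ℝ} (hl : l ∈ Icc (0 : ℝ) 1) (t : ℝ) :
    cfc (powerGeneratorInv t)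
      ((1 - l) • cfc (powerGenerator t) A + l • cfc (powerGenerator t) B) =
        powerMean t l A B := by
  by_cases ht : t = 0
  · subst ht
    rw [powerMean_zero_of_commute hA hB hAB, powerGenerator_zero, powerGeneratorInv_zero]
    exact CFC.real_exp_eq_normedSpace_exp
      (((IsSelfAdjoint.all (1 - l)).smul IsSelfAdjoint.log).add
        ((IsSelfAdjoint.all l).smul IsSelfAdjoint.log))
  · rw [powerMean_of_commute hA hB hAB hl ht, powerGenerator_of_ne_zero ht,
      powerGeneratorInv_of_ne_zero ht, ← CFC.rpow_eq_cfc_real hA.nonneg,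
      ← CFC.rpow_eq_cfc_real hB.nonneg,
      ← CFC.rpow_eq_cfc_real
        (isStrictlyPositive_convexComb (hA.rpow _ t) (hB.rpow _ t) hl).nonneg]

/-- On commuting operators, the power mean is the quasi-arithmetic mean generated by any function
that is affinely equivalent to `powerGenerator t`. -/
lemma eqQuasiArithmetic_powerMean {g : ℝ → ℝ} {t k β : ℝ} (hk : k ≠ 0)
    (hg : ∀ x, 0 < x → g x = k * powerGenerator t x + β) {A B : H →L[ℂ] H}
    (hA : IsStrictlyPositive A) (hB : IsStrictlyPositive B) (hAB : Commute A B) {l : ℝ}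
    (hl : l ∈ Icc (0 : ℝ) 1) : EqQuasiArithmetic g l A B (powerMean t l A B) := by
  have hcont : ∀ C : H →L[ℂ] H, IsStrictlyPositive C →
      ContinuousOn (powerGenerator t) (spectrum ℝ C) := fun C hC =>
    (continuousOn_powerGenerator t).mono fun x hx => hC.spectrum_pos hx
  have hgcont : ∀ C : H →L[ℂ] H, IsStrictlyPositive C → ContinuousOn g (spectrum ℝ C) :=
    fun C hC => ((continuousOn_const.mul (hcont C hC)).add continuousOn_const).congr
      fun x hx => hg x (hC.spectrum_pos hx)
  have hcfc : ∀ C : H →L[ℂ] H, IsStrictlyPositive C →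
      cfc g C = k • cfc (powerGenerator t) C + algebraMap ℝ _ β := fun C hC => by
    rw [cfc_congr (g := fun x => k * powerGenerator t x + β)
        fun x hx => hg x (hC.spectrum_pos hx),
      cfc_add_const β (fun x => k * powerGenerator t x) C (continuousOn_const.mul (hcont C hC)) hC.isSelfAdjoint,
      cfc_const_mul k (powerGenerator t) C (hcont C hC)]
  set Y := (1 - l) • cfc (powerGenerator t) A + l • cfc (powerGenerator t) B with hY
  have hYsa : IsSelfAdjoint Y :=
    ((IsSelfAdjoint.all (1 - l)).smul (cfc_predicate _ A)).add
      ((IsSelfAdjoint.all l).smul (cfc_predicate _ B))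
  have hX : (1 - l) • cfc g A + l • cfc g B = cfc (fun y => k * y + β) Y := by
    rw [cfc_add_const β (fun y => k * y) Y, cfc_const_mul_id k Y, hcfc A hA, hcfc B hB, hY]
    module
  have hspecY : spectrum ℝ Y ⊆ powerGenerator t '' Ioi 0 :=
    spectrum_powerGenerator_comb_subset hA hB hl t
  have hspecX : spectrum ℝ ((1 - l) • cfc g A + l • cfc g B) =
      (fun y => k * y + β) '' spectrum ℝ Y := by
    rw [hX, cfc_map_spectrum (fun y => k * y + β) Y]
  have hginj : InjOn g (Ioi 0) := fun x hx y hy h => by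
    rw [hg x hx, hg y hy, add_left_inj] at h
    rw [← powerGeneratorInv_powerGenerator t hx, mul_left_cancel₀ hk h,
      powerGeneratorInv_powerGenerator t hy]
  -- The inverse of `g` undoes the affine change of generator, so `k` and `β` drop out of the mean.
  have hinv : ∀ y ∈ spectrum ℝ Y, inverseFn g (k * y + β) = powerGeneratorInv t y := by
    intro y hy
    obtain ⟨x, hx, rfl⟩ := hspecY hy
    rw [← hg x hx, powerGeneratorInv_powerGenerator t hx]
    exact hginj.leftInvOn_invFunOn hx
  have hinvcont : ContinuousOn (inverseFn g) ((fun y => k * y + β) '' spectrum ℝ Y) := by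
    have h : ContinuousOn (fun x => powerGeneratorInv t ((x - β) / k))
        ((fun y => k * y + β) '' spectrum ℝ Y) := by
      refine (continuousOn_powerGeneratorInv t).comp (by fun_prop) ?_
      rintro _ ⟨y, hy, rfl⟩
      simpa [mul_div_cancel_left₀ y hk] using hspecY hy
    refine h.congr ?_
    rintro _ ⟨y, hy, rfl⟩
    simp [hinv y hy, mul_div_cancel_left₀ y hk]
  refine ⟨hgcont A hA, hgcont B hB, ?_, ?_, ?_⟩
  · rw [hspecX]
    rintro _ ⟨y, hy, rfl⟩
    obtain ⟨x, hx, rfl⟩ := hspecY hy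
    exact ⟨x, hx, hg x hx⟩
  · rwa [hspecX]
  · rw [hX, ← cfc_comp' (inverseFn g) (fun y => k * y + β) Y hinvcont, cfc_congr hinv,
      cfc_powerGeneratorInv_comb hA hB hAB hl t]

end QuasiArithmetic

/-! ### Restriction to scalar operators. -/

section Scalar

lemma smul_one_le_smul_one_iff [Nontrivial H] {a b : ℝ} :
    a • (1 : H →L[ℂ] H) ≤ b • (1 : H →L[ℂ] H) ↔ a ≤ b := by
  simp only [← Algebra.algebraMap_eq_smul_one]
  exact algebraMap_le_algebraMap

lemma isStrictlyPositive_smul_one {a : ℝ} (ha : 0 < a) :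
    IsStrictlyPositive (a • (1 : H →L[ℂ] H)) :=
  isStrictlyPositive_one.smul ha

omit [CompleteSpace H] in
lemma arithMean_smul_one (l a b : ℝ) :
    arithMean l (a • (1 : H →L[ℂ] H)) (b • (1 : H →L[ℂ] H)) =
      ((1 - l) * a + l * b) • (1 : H →L[ℂ] H) := by
  rw [arithMean]
  module

omit [CompleteSpace H] in
lemma inverse_smul_one {a : ℝ} (ha : a ≠ 0) :
    Ring.inverse (a • (1 : H →L[ℂ] H)) = a⁻¹ • (1 : H →L[ℂ] H) :=
  Ring.inverse_unit ⟨a • 1, a⁻¹ • 1, by simp [smul_smul, ha], by simp [smul_smul, ha]⟩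

omit [CompleteSpace H] in
lemma harmMean_smul_one {l a b : ℝ} (hl : l ∈ Icc (0 : ℝ) 1) (ha : 0 < a) (hb : 0 < b) :
    harmMean l (a • (1 : H →L[ℂ] H)) (b • (1 : H →L[ℂ] H)) =
      ((1 - l) * a⁻¹ + l * b⁻¹)⁻¹ • (1 : H →L[ℂ] H) := by
  have h : (1 - l) * a⁻¹ + l * b⁻¹ ≠ 0 :=
    ((convex_Ioi (0 : ℝ)) (inv_pos.2 ha) (inv_pos.2 hb) (sub_nonneg.2 hl.2) hl.1
      (by ring)).ne'
  rw [harmMean, inverse_smul_one ha.ne', inverse_smul_one hb.ne', smul_smul, smul_smul, ← add_smul,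
    inverse_smul_one h]

/-- Operator means are homogeneous. -/
lemma IsOperatorMean.smul_smul {σ : (H →L[ℂ] H) → (H →L[ℂ] H) → (H →L[ℂ] H)}
    (hσ : IsOperatorMean σ) {A B : H →L[ℂ] H} (hA : 0 ≤ A) (hB : 0 ≤ B) {c : ℝ} (hc : 0 < c) :
    σ (c • A) (c • B) = c • σ A B := by
  -- The transformer inequality with `X = √d • 1` gives one direction; using it again with `c⁻¹`
  -- reverses it.
  have key : ∀ (d : ℝ) (C D : H →L[ℂ] H), 0 < d → 0 ≤ C → 0 ≤ D →
      d • σ C D ≤ σ (d • C) (d • D) := by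
    intro d C D hd hC hD
    have h := hσ.transformer C D (√d • 1) hC hD
    simpa [_root_.smul_smul, Real.mul_self_sqrt hd.le] using h
  refine le_antisymm ?_ (key c A B hc hA hB)
  have h := smul_le_smul_of_nonneg_left (key c⁻¹ (c • A) (c • B) (inv_pos.2 hc)
    (smul_nonneg hc.le hA) (smul_nonneg hc.le hB)) hc.le
  simpa [_root_.smul_smul, hc.ne'] using h

/-- On scalar operators, a quasi-arithmetic mean is computed by the generator. -/
lemma EqQuasiArithmetic.exists_smul_one [Nontrivial H] {g : ℝ → ℝ} {l a b : ℝ}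
    {S : H →L[ℂ] H}
    (h : EqQuasiArithmetic g l (a • (1 : H →L[ℂ] H)) (b • (1 : H →L[ℂ] H)) S) :
    ∃ m, 0 < m ∧ g m = (1 - l) * g a + l * g b ∧ S = m • (1 : H →L[ℂ] H) := by
  have hcfc : (1 - l) • cfc g (a • (1 : H →L[ℂ] H)) + l • cfc g (b • (1 : H →L[ℂ] H)) =
      algebraMap ℝ (H →L[ℂ] H) ((1 - l) * g a + l * g b) := by
    simp only [← Algebra.algebraMap_eq_smul_one, cfc_algebraMap]
    simp only [Algebra.algebraMap_eq_smul_one]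
    module
  have hmem : (1 - l) * g a + l * g b ∈ g '' Ioi 0 :=
    h.spectrum_subset (by rw [hcfc, spectrum.scalar_eq]; rfl)
  refine ⟨inverseFn g ((1 - l) * g a + l * g b), Function.invFunOn_mem hmem,
    Function.invFunOn_eq hmem, ?_⟩
  rw [h.eq, hcfc, cfc_algebraMap, Algebra.algebraMap_eq_smul_one]

/-- A family of operator means that lie between the harmonic and the arithmetic means and are
quasi-arithmetic on scalar operators is generated by a power function with exponent in `[-1, 1]`,
or by the logarithm. -/
lemma exists_powerGenerator_of_eqQuasiArithmetic [Nontrivial H]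
    {σ : ℝ → (H →L[ℂ] H) → (H →L[ℂ] H) → (H →L[ℂ] H)}
    (hσ : ∀ l ∈ Icc (0 : ℝ) 1, IsOperatorMean (σ l))
    (hbound : ∀ l ∈ Icc (0 : ℝ) 1, ∀ A B : H →L[ℂ] H,
      IsStrictlyPositive A → IsStrictlyPositive B →
        harmMean l A B ≤ σ l A B ∧ σ l A B ≤ arithMean l A B)
    {g : ℝ → ℝ} (hg : InjOn g (Ioi 0))
    (hq : ∀ l ∈ Icc (0 : ℝ) 1, ∀ a b : ℝ, 0 < a → 0 < b →
      EqQuasiArithmetic g l (a • (1 : H →L[ℂ] H)) (b • (1 : H →L[ℂ] H))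
        (σ l (a • (1 : H →L[ℂ] H)) (b • (1 : H →L[ℂ] H)))) :
    ∃ t ∈ Icc (-1 : ℝ) 1, ∃ k β : ℝ, k ≠ 0 ∧
      ∀ x, 0 < x → g x = k * powerGenerator t x + β := by
  choose! m hpos hm hσm using fun l hl a b ha hb =>
    EqQuasiArithmetic.exists_smul_one (hq l hl a b ha hb)
  have hbd : ∀ l ∈ Icc (0 : ℝ) 1, ∀ a b, 0 < a → 0 < b →
      ((1 - l) * a⁻¹ + l * b⁻¹)⁻¹ ≤ m l a b ∧ m l a b ≤ (1 - l) * a + l * b := by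
    intro l hl a b ha hb
    have h := hbound l hl _ _ (isStrictlyPositive_smul_one ha) (isStrictlyPositive_smul_one hb)
    rwa [harmMean_smul_one hl ha hb, arithMean_smul_one, hσm l hl a b ha hb,
      smul_one_le_smul_one_iff, smul_one_le_smul_one_iff] at h
  have hhom : ∀ l ∈ Icc (0 : ℝ) 1, ∀ c a b, 0 < c → 0 < a → 0 < b →
      m l (c * a) (c * b) = c * m l a b := by
    intro l hl c a b hc ha hb
    have h := (hσ l hl).smul_smul (isStrictlyPositive_smul_one ha).nonneg
      (isStrictlyPositive_smul_one (H := H) hb).nonneg hc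
    rw [_root_.smul_smul, _root_.smul_smul, hσm l hl _ _ (mul_pos hc ha) (mul_pos hc hb),
      hσm l hl a b ha hb, _root_.smul_smul] at h
    exact le_antisymm (smul_one_le_smul_one_iff.1 h.le) (smul_one_le_smul_one_iff.1 h.ge)
  obtain ⟨t, k, β, hk, h⟩ := exists_powerGenerator_of_homogeneous hg hpos hm hhom
    fun l hl a b ha hab => by
      have hb := ha.trans_le hab
      obtain ⟨h₁, h₂⟩ := hbd l hl a b ha hb
      have h₃ : b⁻¹ ≤ a⁻¹ := inv_anti₀ ha hab
      have h₄ : 0 < (1 - l) * a⁻¹ + l * b⁻¹ :=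
        (convex_Ioi (0 : ℝ)) (inv_pos.2 ha) (inv_pos.2 hb) (sub_nonneg.2 hl.2) hl.1 (by ring)
      have h₅ : a ≤ ((1 - l) * a⁻¹ + l * b⁻¹)⁻¹ := by
        rw [le_inv_comm₀ ha h₄]
        linarith [mul_le_mul_of_nonneg_left h₃ hl.1]
      exact ⟨h₅.trans h₁, by linarith [mul_le_mul_of_nonneg_left hab (sub_nonneg.2 hl.2)]⟩
  have hhalf : (1 / 2 : ℝ) ∈ Icc (0 : ℝ) 1 := by norm_num
  have hy := hpos _ hhalf 1 2 one_pos two_pos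
  have heq := hm _ hhalf 1 2 one_pos two_pos
  obtain ⟨hz, hy'⟩ := hbd _ hhalf 1 2 one_pos two_pos
  rw [h _ hy, h 1 one_pos, h 2 two_pos] at heq
  exact ⟨t, exponent_mem_Icc (β := β) hk hy (by linarith) (by norm_num at hz; exact hz)
    (by linarith) (by linarith), k, β, hk, h⟩

end Scalar

end OpMean

/-! ### The equivalence. -/

theorem theorem5p1 {H : Type*} [NormedAddCommGroup H] [InnerProductSpace ℂ H] [CompleteSpace H]
    (σ : ℝ → (H →L[ℂ] H) → (H →L[ℂ] H) → (H →L[ℂ] H))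
    (hσ : ∀ lam ∈ Set.Icc (0 : ℝ) 1, OpMean.IsWeightedOperatorMean lam (σ lam))
    (hbound : ∀ lam ∈ Set.Icc (0 : ℝ) 1, ∀ A B : H →L[ℂ] H,
      IsStrictlyPositive A → IsStrictlyPositive B →
        OpMean.harmMean lam A B ≤ σ lam A B ∧ σ lam A B ≤ OpMean.arithMean lam A B) :
    (∃ t ∈ Set.Icc (-1 : ℝ) 1, ∀ lam ∈ Set.Icc (0 : ℝ) 1, ∀ A B : H →L[ℂ] H,
      IsStrictlyPositive A → IsStrictlyPositive B → Commute A B →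
        σ lam A B = OpMean.powerMean t lam A B) ↔
    (∃ g : ℝ → ℝ, Set.InjOn g (Set.Ioi 0) ∧
      ∀ lam ∈ Set.Icc (0 : ℝ) 1, ∀ A B : H →L[ℂ] H,
        IsStrictlyPositive A → IsStrictlyPositive B → Commute A B →
          OpMean.EqQuasiArithmetic g lam A B (σ lam A B)) := by
  have hpow : ∀ {g : ℝ → ℝ} {t k β : ℝ}, k ≠ 0 →
      (∀ x, 0 < x → g x = k * powerGenerator t x + β) → ∀ lam ∈ Set.Icc (0 : ℝ) 1,
      ∀ A B : H →L[ℂ] H, IsStrictlyPositive A → IsStrictlyPositive B → Commute A B →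
        OpMean.EqQuasiArithmetic g lam A B (OpMean.powerMean t lam A B) :=
    fun hk hg lam hlam A B hA hB hAB => OpMean.eqQuasiArithmetic_powerMean hk hg hA hB hAB hlam
  constructor
  · rintro ⟨t, -, h⟩
    refine ⟨powerGenerator t, fun x hx y hy hxy => ?_, fun lam hlam A B hA hB hAB => ?_⟩
    · rw [← OpMean.powerGeneratorInv_powerGenerator t hx, hxy,
        OpMean.powerGeneratorInv_powerGenerator t hy]
    · rw [h lam hlam A B hA hB hAB]
      exact hpow (β := 0) one_ne_zero (fun x _ => by simp) lam hlam A B hA hB hAB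
  · rintro ⟨g, hg, h⟩
    rcases subsingleton_or_nontrivial H with hH | hH
    · exact ⟨0, by norm_num, fun lam _ A B _ _ _ => Subsingleton.elim _ _⟩
    · obtain ⟨t, ht, k, β, hk, hgt⟩ := OpMean.exists_powerGenerator_of_eqQuasiArithmetic
        (fun lam hlam => (hσ lam hlam).1) hbound hg fun lam hlam a b ha hb =>
          h lam hlam _ _ (OpMean.isStrictlyPositive_smul_one ha)
            (OpMean.isStrictlyPositive_smul_one hb)
            ((Commute.one_left _).smul_left a)
      refine ⟨t, ht, fun lam hlam A B hA hB hAB => ?_⟩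
      -- Both means equal the same functional-calculus expression in `g`, `A` and `B`.
      rw [(h lam hlam A B hA hB hAB).eq, (hpow hk hgt lam hlam A B hA hB hAB).eq]
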